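/- Let $V$ be a complex vector space and let $B\subset V^*$ be a finite spanning multiset of nonzero linear forms, with $\lambda_B\colon V\to\mathbb C^B$, $v\mapsto(\langle b,v\rangle)_{b\in B}$. Let $\mathcal H^c_B:=\lambda_B(V)\cap(\mathbb C^\times)^B$, the image of the complement of the hyperplane arrangement $\mathcal H$ defined by $B$. A *flat* of $\mathcal H$ is the intersection $L$ of all hyperplanes of $\mathcal H$ containing some given point of $V$. A *flag of flats* is a chain $\mathcal L=(\{0\}=L_0\subsetneq L_1\subsetneq\dots\subsetneq L_k\subsetneq L_{k+1}=V)$ of flats with $k\ge 0$; put $F_i:=\{b\in B: b|_{L_i}\equiv0\}$, and define $$\mathcal H(\mathcal L)^c:=\prod_{i=1}^{k+1}\bigl((\mathcal H/L_{i-1})|_{L_i}\bigr)^c\subset\prod_{i=1}^{k+1}(\mathbb C^\times)^{F_{i-1}\smallsetminus F_i}=(\mathbb C^\times)^B,$$ where the $i$-th factor is the image, under the forms in $F_{i-1}\smallsetminus F_i$, of the complement of the arrangement these forms define in $L_i/L_{i-1}$. For $\omega\in\mathbb R^B$ let $B_\omega$ be the set of bases of $V^*$ contained in $B$ of maximal $\omega$-weight,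 and let $\mathscr T(B)$ be the set of $\omega$ such that every element of $B$ lies in some member of $B_\omega$. Let $\sigma_{\mathcal L}$ be the closure of the set of $\omega\in\mathscr T(B)$ that are constant on each $F_{i-1}\smallsetminus F_i$ with $\omega|_{F_i\smallsetminus F_{i+1}}>\omega|_{F_{i-1}\smallsetminus F_i}$ for $1\le i\le k$. The cones $\sigma_{\mathcal L}$, for all flags of flats $\mathcal L$, form the *fine subdivision* of $\mathscr T(B)$. For $X\subset(\mathbb C^\times)^B$ and $\alpha\in\mathbb Z^B$ the initial scheme $\mathrm{in}_\alpha X$ is the scheme-theoretic fibre over $t=0$ of the closure in $\mathbb C\times(\mathbb C^\times)^B$ of $\{(t,x)\in\mathbb C^\times\times(\mathbb C^\times)^B:\alpha(t)\cdot x\in X\}$, where $\alpha(t)\cdot x=(t^{\alpha_b}x_b)_{b\in B}$. When $\mathrm{in}_\alpha X$ is the same for all $\alpha\in\mathbb Z^B$ in the relative interior of a cone $\sigma$ (and there are such $\alpha$), it is denoted $\mathrm{in}_\sigma X$. The coamoeba $\mathit{c}\mathscr A(X)\subset\mathbb T^B$ is the image of $X$ under $\mathrm{Arg}\colon(z_b)_b\mapsto(z_b/|z_b|)_b$,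 and $\mathscr P^\infty_\sigma(X):=\overline{\mathit{c}\mathscr A(\mathrm{in}_\sigma X)}$. The phase limit set $\mathscr P^\infty(X)$ is the set of accumulation points of sequences $(\mathrm{Arg}(x_n))_n$ with $x_n\in X$ and $\|\mathrm{Log}(x_n)\|\to\infty$, where $\mathrm{Log}(z)=(\log|z_b|)_b$. Its strata, with respect to a given fan, are the sets $\mathscr P^\infty_\sigma(X)$ for the cones $\sigma$ of the fan other than the minimal cone. Then: 1. For every flag of flats $\mathcal L$, the relative interior of $\sigma_{\mathcal L}$ contains points of $\mathbb Z^B$, and for every such point $\alpha$ we have $\mathrm{in}_\alpha\mathcal H^c_B=\mathcal H(\mathcal L)^c$, an equality of closed subschemes of $(\mathbb C^\times)^B$, the right-hand side being a closed subvariety with its reduced structure. Hence $\mathrm{in}_{\sigma_{\mathcal L}}\mathcal H^c_B=\mathcal H(\mathcal L)^c$. 2. For every flag of flats $\mathcal L$, $\mathscr P^\infty_{\sigma_{\mathcal L}}(\mathcal H^c_B)=\overline{\mathit{c}\mathscr A(\mathcal H(\mathcal L)^c)}$. 3. The strata of $\mathscr P^\infty(\mathcal H^c_B)$ with respect to the fine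 subdivision of $\mathscr T(B)$ are exactly the closures $\overline{\mathit{c}\mathscr A(\mathcal H(\mathcal L)^c)}$, where $\mathcal L$ ranges over the flags of flats other than $\{0\}\subsetneq V$, and each of them is contained in $\mathscr P^\infty(\mathcal H^c_B)$. -/

import Mathlib

noncomputable section

namespace PhaseLimit

/-! ### The algebraic torus, its coordinate ring, amoeba map and coamoebas -/

/-- The torus `(ℂˣ)^ι`. -/
abbrev Torus (ι : Type*) : Type _ := ι → ℂˣ

/-- The compact torus `𝕋^ι`, where `𝕋` is the unit circle in `ℂ`. -/
abbrev CompactTorus (ι : Type*) : Type _ := ι → Circle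

/-- The coordinate ring `ℂ[xᵢ, xᵢ⁻¹ | i ∈ ι]` of the torus (Laurent polynomials). -/
abbrev Laurent (ι : Type*) : Type _ := AddMonoidAlgebra ℂ (ι → ℤ)

/-- The argument `z / |z|` of a nonzero complex number. -/
def argUnit (z : ℂˣ) : Circle :=
  ⟨(z : ℂ) / ((‖(z : ℂ)‖ : ℝ) : ℂ), by simp [Submonoid.unitSphere]⟩

/-- The map `Arg : (ℂˣ)^ι → 𝕋^ι`. -/
def Arg {ι : Type*} (x : Torus ι) : CompactTorus ι := fun i => argUnit (x i)

/-- The map `Log : (ℂˣ)^ι → ℝ^ι`. -/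
def Log {ι : Type*} (x : Torus ι) : ι → ℝ := fun i => Real.log ‖(x i : ℂ)‖

/-- The coamoeba of a subset of the torus. -/
def coamoeba {ι : Type*} (X : Set (Torus ι)) : Set (CompactTorus ι) := Arg '' X

/-- The phase limit set of `X`: accumulation points of the arguments of sequences in `X` that
go to infinity in the torus. -/
def phaseLimitSet {ι : Type*} [Fintype ι] (X : Set (Torus ι)) : Set (CompactTorus ι) :=
  {θ | ∃ x : ℕ → Torus ι, (∀ n, x n ∈ X) ∧
    Filter.Tendsto (fun n => ‖Log (x n)‖) Filter.atTop Filter.atTop ∧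
    MapClusterPt θ Filter.atTop (fun n => Arg (x n))}

/-- The character `x ↦ ∏ᵢ xᵢ ^ mᵢ`, as a function of the exponent `m`. -/
def monomialHom {ι : Type*} [Fintype ι] (x : Torus ι) : Multiplicative (ι → ℤ) →* ℂ where
  toFun m := ((∏ i, x i ^ (Multiplicative.toAdd m i) : ℂˣ) : ℂ)
  map_one' := by simp
  map_mul' m n := by
    rw [← Units.val_mul, ← Finset.prod_mul_distrib]
    simp [zpow_add]

/-- Evaluation of Laurent polynomials at a point of the torus. -/
def evalAt {ι : Type*} [Fintype ι] (x : Torus ι) : Laurent ι →+* ℂ :=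
  (AddMonoidAlgebra.lift ℂ ℂ (ι → ℤ) (monomialHom x)).toRingHom

/-- The ideal of Laurent polynomials vanishing on a subset of the torus. -/
def vanishingIdeal {ι : Type*} [Fintype ι] (X : Set (Torus ι)) : Ideal (Laurent ι) :=
  ⨅ x ∈ X, RingHom.ker (evalAt x)

/-- The set of closed points of the closed subscheme of the torus defined by `J`. -/
def zeroLocus {ι : Type*} [Fintype ι] (J : Ideal (Laurent ι)) : Set (Torus ι) :=
  {x | ∀ f ∈ J, evalAt x f = 0}

/-- The closed subscheme of the torus with ideal `J` is the (reduced) closed subvariety with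
set of points `Y`. In particular `Y` is closed. -/
def SchemeEq {ι : Type*} [Fintype ι] (J : Ideal (Laurent ι)) (Y : Set (Torus ι)) : Prop :=
  J = vanishingIdeal Y ∧ zeroLocus J = Y

/-! ### Initial schemes -/

/-- The action of `t` through the cocharacter with weight `α`: `α(t) · x = (t ^ αᵢ xᵢ)ᵢ`. -/
def cocharMul {ι : Type*} (α : ι → ℤ) (t : ℂˣ) (x : Torus ι) : Torus ι := fun i => t ^ α i * x i

/-- Evaluation of an element of `ℂ[t][xᵢ, xᵢ⁻¹]`, the coordinate ring of `ℂ × (ℂˣ)^ι`, at a point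
`(t, x)`. -/
def evalFamily {ι : Type*} [Fintype ι] (t : ℂ) (x : Torus ι) : Polynomial (Laurent ι) →+* ℂ :=
  Polynomial.eval₂RingHom (evalAt x) t

/-- The ideal of the closure in `ℂ × (ℂˣ)^ι` of the family
`{(t, x) ∈ ℂˣ × (ℂˣ)^ι | α(t) · x ∈ X}`. -/
def familyIdeal {ι : Type*} [Fintype ι] (X : Set (Torus ι)) (α : ι → ℤ) :
    Ideal (Polynomial (Laurent ι)) :=
  ⨅ p ∈ {p : ℂˣ × Torus ι | cocharMul α p.1 p.2 ∈ X}, RingHom.ker (evalFamily (p.1 : ℂ) p.2)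

/-- The ideal of the initial scheme `in_α X`: the scheme-theoretic fibre over `t = 0` of the
closure of the family `{(t, x) | α(t) · x ∈ X}`. -/
def initialIdeal {ι : Type*} [Fintype ι] (X : Set (Torus ι)) (α : ι → ℤ) : Ideal (Laurent ι) :=
  (familyIdeal X α).map (Polynomial.evalRingHom (0 : Laurent ι))

/-- The cocharacters that lie in the relative interior of a cone `σ`. -/
def relintCochars {ι : Type*} [Fintype ι] (σ : Set (ι → ℝ)) : Set (ι → ℤ) :=
  {α | (fun i => (α i : ℝ)) ∈ intrinsicInterior ℝ σ}

/-- The ideal of the initial scheme `in_σ X` of a cone `σ`, the common value of `in_α X` for the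
cocharacters `α` in the relative interior of `σ` (the supremum of a nonempty constant family of
ideals is its value). -/
def coneInitialIdeal {ι : Type*} [Fintype ι] (X : Set (Torus ι)) (σ : Set (ι → ℝ)) :
    Ideal (Laurent ι) :=
  ⨆ α ∈ relintCochars σ, initialIdeal X α

/-- The set `𝒫^∞_σ(X)`: the closure of the coamoeba of `in_σ X`. -/
def coneStratum {ι : Type*} [Fintype ι] (X : Set (Torus ι)) (σ : Set (ι → ℝ)) :
    Set (CompactTorus ι) :=
  closure (coamoeba (zeroLocus (coneInitialIdeal X σ)))

/-- The strata of the phase limit set of `X` with respect to a fan `S` (a set of cones): the sets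
`𝒫^∞_σ(X)` for the cones `σ` of `S` other than the minimal cone. -/
def strata {ι : Type*} [Fintype ι] (X : Set (Torus ι)) (S : Set (Set (ι → ℝ))) :
    Set (Set (CompactTorus ι)) :=
  {P | ∃ σ ∈ S, σ ≠ ⋂₀ S ∧ P = coneStratum X σ}

/-! ### Hyperplane arrangements. A finite multiset of linear forms is a family `b` indexed by a
finite type. -/

/-- The image in the torus of the complement of the arrangement defined by the forms `b i`, under
`v ↦ (b i v)ᵢ`. -/
def complement {V ι : Type*} [AddCommGroup V] [Module ℂ V] (b : ι → Module.Dual ℂ V) :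
    Set (Torus ι) :=
  {z | ∃ v : V, ∀ i, (z i : ℂ) = b i v}

/-- A flat of the arrangement: the intersection of all hyperplanes that contain a given point. -/
def IsFlat {V ι : Type*} [AddCommGroup V] [Module ℂ V] (b : ι → Module.Dual ℂ V)
    (L : Submodule ℂ V) : Prop :=
  ∃ x : V, L = ⨅ i ∈ {i | b i x = 0}, LinearMap.ker (b i)

/-- A flag of flats `{0} = L₀ ⊊ L₁ ⊊ ⋯ ⊊ L_k ⊊ L_{k+1} = V`. -/
structure Flag {V ι : Type*} [AddCommGroup V] [Module ℂ V] (b : ι → Module.Dual ℂ V) where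
  k : ℕ
  L : Fin (k + 2) → Submodule ℂ V
  strictMono : StrictMono L
  isFlat : ∀ j, IsFlat b (L j)
  first : L 0 = ⊥
  last : L (Fin.last (k + 1)) = ⊤

/-- The flat of forms vanishing along a subspace. -/
def formsVanishing {V ι : Type*} [AddCommGroup V] [Module ℂ V] (b : ι → Module.Dual ℂ V)
    (L : Submodule ℂ V) : Set ι :=
  {i | ∀ x ∈ L, b i x = 0}

/-- With `F j` the forms vanishing along `L j`, the set `F j \ F (j + 1)`. -/
def Flag.block {V ι : Type*} [AddCommGroup V] [Module ℂ V] {b : ι → Module.Dual ℂ V}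
    (𝓛 : Flag b) (j : Fin (𝓛.k + 1)) : Set ι :=
  formsVanishing b (𝓛.L j.castSucc) \ formsVanishing b (𝓛.L j.succ)

/-- The forms induced by `F j \ F (j + 1)` on `L (j + 1) / L j`. They define the restriction to
`L (j + 1)` of the contraction by `L j`. -/
def Flag.inducedForms {V ι : Type*} [AddCommGroup V] [Module ℂ V] {b : ι → Module.Dual ℂ V}
    (𝓛 : Flag b) (j : Fin (𝓛.k + 1)) (i : 𝓛.block j) :
    Module.Dual ℂ (𝓛.L j.succ ⧸ (𝓛.L j.castSucc).submoduleOf (𝓛.L j.succ)) :=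
  Submodule.liftQ _ ((b i).domRestrict (𝓛.L j.succ)) (fun x hx => i.2.1 x hx)

/-- The product over `j` of the complements of the arrangements induced on `L (j + 1) / L j`, as
a subset of `∏ⱼ (ℂˣ)^(F j \ F (j + 1)) = (ℂˣ)^ι`. -/
def Flag.complement {V ι : Type*} [AddCommGroup V] [Module ℂ V] {b : ι → Module.Dual ℂ V}
    (𝓛 : Flag b) : Set (Torus ι) :=
  {z | ∀ j, (fun i : 𝓛.block j => z i) ∈ PhaseLimit.complement (𝓛.inducedForms j)}

/-! ### The tropical variety `𝒯(B)` and its fine subdivision -/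

/-- `E` is a basis of the vector configuration `b`. -/
def IsBasis {V ι : Type*} [AddCommGroup V] [Module ℂ V] (b : ι → Module.Dual ℂ V)
    (E : Finset ι) : Prop :=
  LinearIndependent ℂ (fun i : E => b i) ∧ Submodule.span ℂ (b '' (E : Set ι)) = ⊤

/-- The set `B_ω` of bases of maximal weight. -/
def maxBases {V ι : Type*} [AddCommGroup V] [Module ℂ V] (b : ι → Module.Dual ℂ V)
    (ω : ι → ℝ) : Set (Finset ι) :=
  {E | IsBasis b E ∧ ∀ E', IsBasis b E' → ∑ i ∈ E', ω i ≤ ∑ i ∈ E, ω i}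

/-- The set `𝒯(B)` of weights `ω` such that `B_ω` has no loops. -/
def bergman {V ι : Type*} [AddCommGroup V] [Module ℂ V] (b : ι → Module.Dual ℂ V) :
    Set (ι → ℝ) :=
  {ω | ∀ i, ∃ E ∈ maxBases b ω, i ∈ E}

/-- `ω` induces the flag `𝓛`: it is constant on each `F j \ F (j + 1)`, with values that
increase strictly with `j`. -/
def Flag.InducedBy {V ι : Type*} [AddCommGroup V] [Module ℂ V] {b : ι → Module.Dual ℂ V}
    (𝓛 : Flag b) (ω : ι → ℝ) : Prop :=
  (∀ j, ∀ i ∈ 𝓛.block j, ∀ i' ∈ 𝓛.block j, ω i = ω i') ∧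
    ∀ j j', j < j' → ∀ i ∈ 𝓛.block j, ∀ i' ∈ 𝓛.block j', ω i < ω i'

/-- The cone `σ_𝓛`: the closure of the set of weights in `𝒯(B)` that induce the flag `𝓛`. -/
def Flag.cone {V ι : Type*} [AddCommGroup V] [Module ℂ V] {b : ι → Module.Dual ℂ V}
    (𝓛 : Flag b) : Set (ι → ℝ) :=
  closure {ω | ω ∈ bergman b ∧ 𝓛.InducedBy ω}

/-- The fine subdivision of `𝒯(B)`: the cones `σ_𝓛` for all flags of flats `𝓛`. -/
def fineSubdivision {V ι : Type*} [AddCommGroup V] [Module ℂ V] (b : ι → Module.Dual ℂ V) :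
    Set (Set (ι → ℝ)) :=
  Set.range fun 𝓛 : Flag b => 𝓛.cone

end PhaseLimit

end

/-!
Let `X` be the complement and let `ω` be a weight that induces a flag of flats. If `E` is a basis of
maximal `ω`-weight, then basis exchange shows that each form is a combination
`b i = ∑ e ∈ E, c i e • b e` that involves only elements `e` with `ω i ≤ ω e`
(`weight_le_of_coordinate_ne_zero`). A form does not vanish on the larger flat of its block, so at
least one of these elements lies in the same block as `i`
(`IsAdapted.exists_leadingCoeff_ne_zero`). Exchanging it for `i` preserves the weight of the basis,
hence every weight that induces a flag lies in `bergman b` (`Flag.InducedBy.mem_bergman`), and the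
cones are described by weak inequalities between the blocks. Their relative interiors are then given
by the strict inequalities.

For an integral weight `α` the family `{(t, x) | α(t) · x ∈ X}` satisfies the equations
`xᵢ = ∑ e ∈ E, c i e * t ^ (α e - α i) * xₑ`, whose exponents are nonnegative. At `t = 0` only the
coefficients between forms in the same block survive, and the resulting linear equations cut out
the complement of the flag. They generate its vanishing ideal, which is therefore contained in the
initial ideal (`vanishingIdeal_le_of_flagEquation_mem`). Conversely, the same formulas, with the
coordinates along `E` held fixed, describe paths in the family that tend to a given point of the
complement of the flag, so that the initial ideal vanishes there (`IsAdapted.initialIdeal_le`).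

Applying `α(t)` with `t > 0` to these paths gives points of `X` with the same arguments. They go to
infinity if `α` is not zero, which proves that the strata lie in the phase limit set
(`closure_coamoeba_subset_phaseLimitSet`). Finally, the minimal cone is the line of constant weights,
and it is the cone of the flag `{0} ⊊ V` alone (`Flag.cone_eq_sInter_iff`).
-/

namespace PhaseLimit

/-! ### Bases of maximal weight -/

section Bases

variable {V ι : Type*} [AddCommGroup V] [Module ℂ V] {b : ι → Module.Dual ℂ V}

theorem isBasis_iff_card [FiniteDimensional ℂ (Module.Dual ℂ V)] {E : Finset ι} :
    IsBasis b E ↔ Submodule.span ℂ (b '' (E : Set ι)) = ⊤ ∧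
      E.card = Module.finrank ℂ (Module.Dual ℂ V) := by
  have hr : Set.range (fun i : E => b i) = b '' (E : Set ι) := by
    ext x; simp
  constructor
  · rintro ⟨h1, h2⟩
    refine ⟨h2, ?_⟩
    rw [← hr] at h2
    have := Module.finrank_eq_card_basis (Module.Basis.mk h1 h2.ge)
    rw [this, Fintype.card_coe]
  · rintro ⟨h2, h3⟩
    refine ⟨linearIndependent_of_top_le_span_of_card_eq_finrank ?_ ?_, h2⟩
    · rw [hr, h2]
    · rw [Fintype.card_coe, h3]

theorem maxBases_nonempty [Finite ι] [FiniteDimensional ℂ (Module.Dual ℂ V)]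
    (hspan : Submodule.span ℂ (Set.range b) = ⊤) (ω : ι → ℝ) : (maxBases b ω).Nonempty := by
  classical
  have := Fintype.ofFinite ι
  obtain ⟨κ, a, ha, hsp, hli⟩ := exists_linearIndependent' ℂ b
  have hκ : Finite κ := Finite.of_injective a ha
  have := Fintype.ofFinite κ
  have h0 : IsBasis b (Finset.univ.map ⟨a, ha⟩) := by
    refine isBasis_iff_card.2 ⟨?_, ?_⟩
    · rw [← hspan, ← hsp, Set.range_comp]
      simp
    · rw [Finset.card_map, Finset.card_univ,
        Module.finrank_eq_card_basis (Module.Basis.mk hli (by rw [hsp, hspan]))]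
  obtain ⟨E, hE, hmax⟩ := Set.exists_max_image {E | IsBasis b E} (fun E => ∑ i ∈ E, ω i)
    (Set.toFinite _) ⟨_, h0⟩
  exact ⟨E, hE, hmax⟩

/-- The numbers `c i e`, for `e ∈ E`, are the coordinates of the form `b i` in the basis `E` (the
others are irrelevant). The linear independence of `E` is encoded dually, in `solve`: the forms of
`E` take arbitrary prescribed values at a suitable vector. -/
structure IsCoordinates (b : ι → Module.Dual ℂ V) (E : Finset ι) (c : ι → ι → ℂ) : Prop where
  expand : ∀ i, b i = ∑ e ∈ E, c i e • b e
  solve : ∀ y : ι → ℂ, ∃ v : V, ∀ e ∈ E, b e v = y e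

theorem IsBasis.exists_coordinates [FiniteDimensional ℂ V] {E : Finset ι} (hE : IsBasis b E) :
    ∃ c, IsCoordinates b E c := by
  classical
  have hr : Set.range (fun i : E => b i) = b '' (E : Set ι) := by
    ext x; simp
  let B := Module.Basis.mk hE.1 (by rw [hr, hE.2])
  refine ⟨fun i e => if h : e ∈ E then B.repr (b i) ⟨e, h⟩ else 0, ?_, ?_⟩
  · intro i
    conv_lhs => rw [← B.sum_repr (b i)]
    rw [← Finset.sum_coe_sort E]
    refine Finset.sum_congr rfl fun e _ => ?_
    simp [B]
  · intro y
    -- the linear functional on the dual space with prescribed values on the basis is evaluation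
    -- at a vector
    let ψ : Module.Dual ℂ (Module.Dual ℂ V) := B.constr ℂ (fun e : E => y e)
    refine ⟨(Module.evalEquiv ℂ V).symm ψ, fun e he => ?_⟩
    have h1 : b e ((Module.evalEquiv ℂ V).symm ψ) = ψ (b e) := by
      simp
    rw [h1]
    have h2 : b e = B ⟨e, he⟩ := by simp [B]
    rw [h2, Module.Basis.constr_basis]

theorem IsBasis.exchange [DecidableEq ι] [FiniteDimensional ℂ (Module.Dual ℂ V)]
    {E : Finset ι} (hE : IsBasis b E) {c : ι → ι → ℂ} (hc : IsCoordinates b E c) {i e : ι}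
    (he : e ∈ E) (hi : i ∉ E) (hne : c i e ≠ 0) : IsBasis b (insert i (E.erase e)) := by
  rw [isBasis_iff_card] at hE ⊢
  refine ⟨?_, ?_⟩
  · rw [eq_top_iff, ← hE.1, Submodule.span_le]
    have hsub : ∀ x ∈ insert i (E.erase e),
        b x ∈ Submodule.span ℂ (b '' ((insert i (E.erase e) : Finset ι) : Set ι)) :=
      fun x hx => Submodule.subset_span ⟨x, hx, rfl⟩
    rintro _ ⟨x, hx, rfl⟩
    by_cases hxe : x = e
    · subst hxe
      have h1 : b x = (c i x)⁻¹ • (b i - ∑ y ∈ E.erase x, c i y • b y) := by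
        rw [hc.expand i, ← Finset.add_sum_erase E _ he, add_sub_cancel_right, smul_smul,
          inv_mul_cancel₀ hne, one_smul]
      rw [h1]
      refine Submodule.smul_mem _ _ (Submodule.sub_mem _ (hsub _ (Finset.mem_insert_self _ _)) ?_)
      exact Submodule.sum_mem _ fun y hy =>
        Submodule.smul_mem _ _ (hsub _ (Finset.mem_insert_of_mem hy))
    · exact hsub _ (Finset.mem_insert_of_mem (Finset.mem_erase.2 ⟨hxe, hx⟩))
  · rw [Finset.card_insert_of_notMem (by simp [hi]), Finset.card_erase_add_one he, hE.2]

theorem IsCoordinates.apply_of_mem [DecidableEq ι] {E : Finset ι} {c : ι → ι → ℂ}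
    (hc : IsCoordinates b E c) {i e : ι} (hi : i ∈ E) (he : e ∈ E) :
    c i e = if i = e then 1 else 0 := by
  obtain ⟨v, hv⟩ := hc.solve fun x => if x = e then 1 else 0
  have h := LinearMap.congr_fun (hc.expand i) v
  rw [hv i hi, LinearMap.sum_apply] at h
  rw [h, Finset.sum_eq_single_of_mem e he fun x hx hxe => by simp [hv x hx, hxe]]
  simp [hv e he]

/-- In a basis `E` of maximal weight, a form `b i` involves only the elements of `E` that weigh at
least as much as `i`, because otherwise an exchange would increase the weight. -/
theorem weight_le_of_coordinate_ne_zero [FiniteDimensional ℂ (Module.Dual ℂ V)]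
    {ω : ι → ℝ} {E : Finset ι} (hE : E ∈ maxBases b ω) {c : ι → ι → ℂ}
    (hc : IsCoordinates b E c) {i e : ι} (he : e ∈ E) (hne : c i e ≠ 0) :
    ω i ≤ ω e := by
  classical
  by_cases hi : i ∈ E
  · rw [hc.apply_of_mem hi he, ne_eq, ite_eq_right_iff, Classical.not_imp] at hne
    rw [hne.1]
  · have h := hE.2 _ (hE.1.exchange hc he hi hne)
    rw [Finset.sum_insert (by simp [hi]), ← Finset.add_sum_erase E _ he] at h
    linarith

end Bases

/-! ### Flags of flats and their blocks -/

namespace Flag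

variable {V ι : Type*} [AddCommGroup V] [Module ℂ V] {b : ι → Module.Dual ℂ V} (𝓛 : Flag b)

theorem formsVanishing_antitone : Antitone fun j => formsVanishing b (𝓛.L j) :=
  fun _ _ h _ hi x hx => hi x (𝓛.strictMono.monotone h hx)

theorem exists_mem_block (hb : ∀ i, b i ≠ 0) (i : ι) : ∃ j, i ∈ 𝓛.block j := by
  by_contra! h
  have hall : ∀ j, i ∈ formsVanishing b (𝓛.L j) := by
    intro j
    induction j using Fin.induction with
    | zero =>
      intro x hx
      rw [𝓛.first, Submodule.mem_bot] at hx
      rw [hx, map_zero]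
    | succ j ih => exact by_contra fun hn => h j ⟨ih, hn⟩
  have hlast := hall (Fin.last _)
  rw [𝓛.last] at hlast
  exact hb i (LinearMap.ext fun x => hlast x trivial)

theorem block_subset {j j' : Fin (𝓛.k + 1)} (h : j < j') :
    𝓛.block j' ⊆ formsVanishing b (𝓛.L j.succ) :=
  fun _ hi => 𝓛.formsVanishing_antitone (Fin.succ_le_castSucc_iff.2 h) hi.1

theorem eq_of_mem_block {i : ι} {j j' : Fin (𝓛.k + 1)} (h : i ∈ 𝓛.block j)
    (h' : i ∈ 𝓛.block j') : j = j' := by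
  rcases lt_trichotomy j j' with hlt | heq | hlt
  · exact absurd (𝓛.block_subset hlt h') h.2
  · exact heq
  · exact absurd (𝓛.block_subset hlt h) h'.2

/-- A flat is cut out by the forms that vanish along it. -/
theorem mem_of_forall_formsVanishing (j : Fin (𝓛.k + 2)) {v : V}
    (h : ∀ i ∈ formsVanishing b (𝓛.L j), b i v = 0) : v ∈ 𝓛.L j := by
  obtain ⟨x, hx⟩ := 𝓛.isFlat j
  have h' : ∀ i, b i x = 0 → b i v = 0 := fun i hi => h i fun y hy => by
    rw [hx] at hy
    simp only [Set.mem_ofPred_eq, Submodule.mem_iInf, LinearMap.mem_ker] at hy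
    exact hy i hi
  rw [hx]
  simpa [Submodule.mem_iInf] using h'

theorem block_nonempty (j : Fin (𝓛.k + 1)) : (𝓛.block j).Nonempty := by
  by_contra hne
  rw [Set.not_nonempty_iff_eq_empty, block, Set.sdiff_eq_empty] at hne
  refine (𝓛.strictMono (Fin.castSucc_lt_succ (i := j))).not_ge fun v hv => ?_
  exact 𝓛.mem_of_forall_formsVanishing _ fun i hi => hne hi v hv

theorem mem_complement_iff {z : Torus ι} : z ∈ 𝓛.complement ↔
    ∀ j, ∃ v ∈ 𝓛.L j.succ, ∀ i ∈ 𝓛.block j, (z i : ℂ) = b i v := by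
  refine forall_congr' fun j => ⟨?_, ?_⟩
  · rintro ⟨v, hv⟩
    obtain ⟨v, rfl⟩ := Submodule.mkQ_surjective _ v
    exact ⟨v, v.2, fun i hi => hv ⟨i, hi⟩⟩
  · rintro ⟨v, hv, h⟩
    exact ⟨Submodule.mkQ _ ⟨v, hv⟩, fun i => h i i.2⟩

/-- The index of the block that contains a form. As a weight, it induces the flag. -/
noncomputable def level (hb : ∀ i, b i ≠ 0) (i : ι) : Fin (𝓛.k + 1) :=
  (𝓛.exists_mem_block hb i).choose

variable {𝓛} {hb : ∀ i, b i ≠ 0}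

theorem mem_block_iff {i : ι} {j : Fin (𝓛.k + 1)} : i ∈ 𝓛.block j ↔ 𝓛.level hb i = j :=
  have h := (𝓛.exists_mem_block hb i).choose_spec
  ⟨fun hi => 𝓛.eq_of_mem_block h hi, fun hi => hi ▸ h⟩

theorem inducedBy_iff {ω : ι → ℝ} : 𝓛.InducedBy ω ↔
    ∀ i i', (𝓛.level hb i = 𝓛.level hb i' → ω i = ω i') ∧
      (𝓛.level hb i < 𝓛.level hb i' → ω i < ω i') := by
  simp only [InducedBy, mem_block_iff (hb := hb)]
  constructor
  · rintro ⟨h1, h2⟩ i i'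
    exact ⟨fun h => h1 _ i h i' rfl, fun h => h2 _ _ h i rfl i' rfl⟩
  · refine fun h => ⟨?_, ?_⟩
    · rintro j i rfl i' hi'
      exact (h i i').1 hi'.symm
    · rintro j j' hj i rfl i' rfl
      exact (h i i').2 hj

theorem InducedBy.le_iff {ω : ι → ℝ} (h : 𝓛.InducedBy ω) {i i' : ι} :
    ω i ≤ ω i' ↔ 𝓛.level hb i ≤ 𝓛.level hb i' := by
  rw [inducedBy_iff (hb := hb)] at h
  constructor
  · intro hle
    by_contra! hlt
    exact ((h i' i).2 hlt).not_ge hle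
  · intro hle
    rcases hle.eq_or_lt with heq | hlt
    · exact ((h i i').1 heq).le
    · exact ((h i i').2 hlt).le

theorem InducedBy.eq_iff {ω : ι → ℝ} (h : 𝓛.InducedBy ω) {i i' : ι} :
    ω i = ω i' ↔ 𝓛.level hb i = 𝓛.level hb i' := by
  rw [le_antisymm_iff, le_antisymm_iff, h.le_iff (hb := hb), h.le_iff (hb := hb)]

theorem inducedBy_level : 𝓛.InducedBy fun i => ((𝓛.level hb i : ℕ) : ℝ) := by
  rw [inducedBy_iff (hb := hb)]
  intro i i'
  exact ⟨fun h => by rw [h], fun h => by exact_mod_cast h⟩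

end Flag

/-! ### Bases adapted to a flag -/

/-- A basis `E` of the configuration adapted to the flag of flats that is induced by the weight
`ω`: the form `b i` is a combination of the elements of `E` that weigh at least as much as `i`,
with coefficients `c i`. -/
structure IsAdapted {V ι : Type*} [AddCommGroup V] [Module ℂ V] (b : ι → Module.Dual ℂ V)
    (ω : ι → ℝ) (E : Finset ι) (c : ι → ι → ℂ) : Prop extends IsCoordinates b E c where
  weight_le : ∀ {i e}, e ∈ E → c i e ≠ 0 → ω i ≤ ω e

/-- The part of the coefficient matrix `c` that relates forms of equal weight. It defines the
degeneration of the linear space. -/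
noncomputable def leadingCoeff {ι : Type*} (ω : ι → ℝ) (c : ι → ι → ℂ) (i e : ι) : ℂ :=
  if ω i = ω e then c i e else 0

section Adapted

variable {V ι : Type*} [AddCommGroup V] [Module ℂ V] {b : ι → Module.Dual ℂ V}
  {ω : ι → ℝ} {E : Finset ι} {c : ι → ι → ℂ} {𝓛 : Flag b}

theorem IsAdapted.apply_eq (h : IsAdapted b ω E c) (i : ι) (v : V) :
    b i v = ∑ e ∈ E, c i e * b e v := by
  conv_lhs => rw [h.expand i]
  simp [LinearMap.sum_apply]

/-- A form in a block does not vanish on the larger flat of the block, so it involves an element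
of the adapted basis in the same block. -/
theorem IsAdapted.exists_leadingCoeff_ne_zero (h : IsAdapted b ω E c) (hb : ∀ i, b i ≠ 0)
    (hω : 𝓛.InducedBy ω) (i : ι) : ∃ e ∈ E, leadingCoeff ω c i e ≠ 0 := by
  by_contra! hz
  have hi : i ∈ 𝓛.block (𝓛.level hb i) := Flag.mem_block_iff.2 rfl
  refine hi.2 fun x hx => ?_
  rw [h.apply_eq]
  refine Finset.sum_eq_zero fun e he => ?_
  by_cases hce : c i e = 0
  · rw [hce, zero_mul]
  · have hne : ω i ≠ ω e := fun heq => hce (by simpa [leadingCoeff, heq] using hz e he)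
    have hlt : 𝓛.level hb i < 𝓛.level hb e := lt_of_le_of_ne
      ((hω.le_iff).1 (h.weight_le he hce)) fun heq => hne ((hω.eq_iff).2 heq)
    rw [𝓛.block_subset hlt (Flag.mem_block_iff.2 rfl) x hx, mul_zero]

/-- On the complement of a flag, the coordinates along the adapted basis determine the others through
the leading coefficients. -/
theorem IsAdapted.eq_sum_of_mem_complement (h : IsAdapted b ω E c) (hb : ∀ i, b i ≠ 0)
    (hω : 𝓛.InducedBy ω) {z : Torus ι} (hz : z ∈ 𝓛.complement) (i : ι) :
    (z i : ℂ) = ∑ e ∈ E, leadingCoeff ω c i e * z e := by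
  obtain ⟨v, hv, hzv⟩ := 𝓛.mem_complement_iff.1 hz (𝓛.level hb i)
  rw [hzv i (Flag.mem_block_iff.2 rfl), h.apply_eq]
  refine Finset.sum_congr rfl fun e he => ?_
  by_cases hce : c i e = 0
  · simp [leadingCoeff, hce]
  rcases ((hω.le_iff (hb := hb)).1 (h.weight_le he hce)).eq_or_lt with heq | hlt
  · rw [leadingCoeff, if_pos (hω.eq_iff.2 heq), hzv e (Flag.mem_block_iff.2 heq.symm)]
  · rw [leadingCoeff, if_neg fun h' => hlt.ne (hω.eq_iff.1 h'),
      𝓛.block_subset hlt (Flag.mem_block_iff.2 rfl) v hv, mul_zero, zero_mul]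

/-- The points of the torus in the image of the leading coefficients belong to the complement of
the flag. -/
theorem IsAdapted.mem_complement (h : IsAdapted b ω E c) (hb : ∀ i, b i ≠ 0)
    (hω : 𝓛.InducedBy ω) {z : Torus ι} (u : ι → ℂ)
    (hz : ∀ i, (z i : ℂ) = ∑ e ∈ E, leadingCoeff ω c i e * u e) : z ∈ 𝓛.complement := by
  rw [Flag.mem_complement_iff]
  intro j
  obtain ⟨v, hv⟩ := h.solve fun e => if 𝓛.level hb e = j then u e else 0
  refine ⟨v, 𝓛.mem_of_forall_formsVanishing _ fun i hi => ?_, fun i hi => ?_⟩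
  · have hji : j < 𝓛.level hb i := by
      by_contra! hle
      have hmem : i ∈ 𝓛.block (𝓛.level hb i) := Flag.mem_block_iff.2 rfl
      exact hmem.2 (𝓛.formsVanishing_antitone (Fin.succ_le_succ_iff.2 hle) hi)
    rw [h.apply_eq]
    refine Finset.sum_eq_zero fun e he => ?_
    by_cases hce : c i e = 0
    · rw [hce, zero_mul]
    have hie : 𝓛.level hb i ≤ 𝓛.level hb e := hω.le_iff.1 (h.weight_le he hce)
    rw [hv e he, if_neg (hji.trans_le hie).ne', mul_zero]
  · rw [Flag.mem_block_iff (hb := hb)] at hi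
    rw [hz, h.apply_eq]
    refine Finset.sum_congr rfl fun e he => ?_
    rw [hv e he, leadingCoeff, ← hi]
    by_cases heq : 𝓛.level hb i = 𝓛.level hb e
    · rw [if_pos (hω.eq_iff.2 heq), if_pos heq.symm]
    · rw [if_neg fun h' => heq (hω.eq_iff.1 h'), if_neg fun h' => heq h'.symm, mul_zero, zero_mul]

theorem exists_isAdapted [Finite ι] [FiniteDimensional ℂ V]
    (hspan : Submodule.span ℂ (Set.range b) = ⊤) (ω : ι → ℝ) :
    ∃ E ∈ maxBases b ω, ∃ c, IsAdapted b ω E c := by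
  obtain ⟨E, hE⟩ := maxBases_nonempty hspan ω
  obtain ⟨c, hc⟩ := hE.1.exists_coordinates
  exact ⟨E, hE, c, hc, weight_le_of_coordinate_ne_zero hE hc⟩

/-- Every form can be exchanged into a basis of maximal weight, at the expense of an element of
the same block. -/
theorem Flag.InducedBy.mem_bergman [Finite ι] [FiniteDimensional ℂ V]
    (hspan : Submodule.span ℂ (Set.range b) = ⊤) (hb : ∀ i, b i ≠ 0) (hω : 𝓛.InducedBy ω) :
    ω ∈ bergman b := by
  classical
  intro i
  obtain ⟨E, hE, c, hc⟩ := exists_isAdapted hspan ω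
  by_cases hi : i ∈ E
  · exact ⟨E, hE, hi⟩
  obtain ⟨e, he, hne⟩ := hc.exists_leadingCoeff_ne_zero hb hω i
  rw [leadingCoeff, ne_eq, ite_eq_right_iff, Classical.not_imp] at hne
  refine ⟨_, ⟨hE.1.exchange hc.toIsCoordinates he hi hne.2, fun E' hE' => ?_⟩,
    Finset.mem_insert_self _ _⟩
  rw [Finset.sum_insert (by simp [hi]), hne.1, Finset.add_sum_erase E _ he]
  exact hE.2 E' hE'

end Adapted

/-! ### The cones of the fine subdivision -/

section Cones

open Filter Topology

variable {V ι : Type*} [AddCommGroup V] [Module ℂ V]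
  {b : ι → Module.Dual ℂ V} {𝓛 : Flag b} {hb : ∀ i, b i ≠ 0}

namespace Flag

theorem le_of_mem_cone {ω : ι → ℝ} (hω : ω ∈ 𝓛.cone) {i i' : ι}
    (h : 𝓛.level hb i ≤ 𝓛.level hb i') : ω i ≤ ω i' := by
  have hcl : IsClosed {ω : ι → ℝ | ω i ≤ ω i'} :=
    isClosed_le (continuous_apply i) (continuous_apply i')
  exact closure_minimal (fun ω h' => h'.2.le_iff.2 h) hcl hω

variable [FiniteDimensional ℂ V]

theorem cone_eq_closure_inducedBy [Finite ι] (hspan : Submodule.span ℂ (Set.range b) = ⊤)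
    (hb : ∀ i, b i ≠ 0) : 𝓛.cone = closure {ω | 𝓛.InducedBy ω} := by
  rw [cone]
  congr 1
  ext ω
  exact ⟨fun h => h.2, fun h => ⟨h.mem_bergman hspan hb, h⟩⟩

theorem const_mem_cone [Finite ι] (hspan : Submodule.span ℂ (Set.range b) = ⊤)
    (hb : ∀ i, b i ≠ 0) (a : ℝ) : (fun _ => a) ∈ 𝓛.cone := by
  rw [cone_eq_closure_inducedBy hspan hb]
  have ht : Tendsto (fun ε : ℝ => fun i => a + ε * ((𝓛.level hb i : ℕ) : ℝ)) (𝓝[>] 0)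
      (𝓝 fun _ => a) := by
    refine tendsto_nhdsWithin_of_tendsto_nhds (Continuous.tendsto' (by fun_prop) _ _ ?_)
    simp
  refine mem_closure_of_tendsto ht ?_
  filter_upwards [self_mem_nhdsWithin] with ε (hε : 0 < ε)
  refine (inducedBy_iff (hb := hb)).2 ?_
  refine fun i i' => ⟨fun h => by rw [h], fun h => ?_⟩
  have h' : ((𝓛.level hb i : ℕ) : ℝ) < ((𝓛.level hb i' : ℕ) : ℝ) := by exact_mod_cast h
  gcongr

/-- The flag `{0} ⊊ V`. Both terms are flats because they are terms of the given flag. -/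
def trivialFlag (𝓛 : Flag b) : Flag b where
  k := 0
  L := ![⊥, ⊤]
  strictMono := by
    have h := 𝓛.strictMono (Fin.last_pos (n := 𝓛.k))
    rw [𝓛.first, 𝓛.last] at h
    intro i j hij
    fin_cases i <;> fin_cases j <;> simp_all
  isFlat := by
    have h0 := 𝓛.isFlat 0
    have h1 := 𝓛.isFlat (Fin.last _)
    rw [𝓛.first] at h0
    rw [𝓛.last] at h1
    intro j
    fin_cases j
    · exact h0
    · exact h1
  first := rfl
  last := rfl

/-- The minimal cone is the line of constant weights, which is the cone of the trivial flag. -/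
theorem sInter_fineSubdivision [Finite ι] (hspan : Submodule.span ℂ (Set.range b) = ⊤)
    (hb : ∀ i, b i ≠ 0) (𝓛 : Flag b) :
    ⋂₀ fineSubdivision b = {ω | ∀ i i', ω i = ω i'} := by
  ext ω
  rw [Set.mem_sInter, Set.mem_ofPred_eq]
  constructor
  · intro h i i'
    have h' := h _ ⟨𝓛.trivialFlag, rfl⟩
    have heq : 𝓛.trivialFlag.level hb i = 𝓛.trivialFlag.level hb i' :=
      Subsingleton.elim (α := Fin 1) _ _
    exact le_antisymm (le_of_mem_cone h' heq.le) (le_of_mem_cone h' heq.ge)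
  · rintro h _ ⟨𝓛', rfl⟩
    obtain ⟨i₀, -⟩ := 𝓛.block_nonempty 0
    rw [show ω = fun _ => ω i₀ from funext fun i => h i i₀]
    exact const_mem_cone hspan hb _

theorem cone_eq_sInter_iff [Finite ι] (hspan : Submodule.span ℂ (Set.range b) = ⊤)
    (hb : ∀ i, b i ≠ 0) (𝓛 : Flag b) : 𝓛.cone = ⋂₀ fineSubdivision b ↔ 𝓛.k = 0 := by
  rw [sInter_fineSubdivision hspan hb 𝓛]
  constructor
  · intro h
    have hmem : (fun i => ((𝓛.level hb i : ℕ) : ℝ)) ∈ 𝓛.cone := by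
      rw [cone_eq_closure_inducedBy hspan hb]
      exact subset_closure inducedBy_level
    rw [h] at hmem
    obtain ⟨i, hi⟩ := 𝓛.block_nonempty 0
    obtain ⟨i', hi'⟩ := 𝓛.block_nonempty (Fin.last _)
    rw [mem_block_iff (hb := hb)] at hi hi'
    have h2 : ((𝓛.level hb i : ℕ) : ℝ) = ((𝓛.level hb i' : ℕ) : ℝ) := hmem i i'
    rw [hi, hi'] at h2
    have h3 : ((0 : Fin (𝓛.k + 1)) : ℕ) = (Fin.last 𝓛.k : ℕ) := by exact_mod_cast h2
    simpa using h3.symm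
  · intro hk
    refine Set.Subset.antisymm (fun ω hω i i' => ?_) (fun ω h => ?_)
    · have heq : 𝓛.level hb i = 𝓛.level hb i' := by
        ext
        have := (𝓛.level hb i).2
        have := (𝓛.level hb i').2
        omega
      exact le_antisymm (le_of_mem_cone hω heq.le) (le_of_mem_cone hω heq.ge)
    · obtain ⟨i₀, -⟩ := 𝓛.block_nonempty 0
      rw [show ω = fun _ => ω i₀ from funext fun i => h i i₀]
      exact const_mem_cone hspan hb _

/-- The inequalities of a flag are strict at a relative interior point, because it stays in the cone
when it is pushed a little away from the weight `level`, where they are strict. -/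
theorem inducedBy_of_mem_intrinsicInterior [Fintype ι]
    (hspan : Submodule.span ℂ (Set.range b) = ⊤) (hb : ∀ i, b i ≠ 0) {ω : ι → ℝ}
    (hω : ω ∈ intrinsicInterior ℝ 𝓛.cone) : 𝓛.InducedBy ω := by
  have hωc := intrinsicInterior_subset hω
  let ω₀ : ι → ℝ := fun i => ((𝓛.level hb i : ℕ) : ℝ)
  have hω₀ : ω₀ ∈ 𝓛.cone := by
    rw [cone_eq_closure_inducedBy hspan hb]
    exact subset_closure inducedBy_level
  obtain ⟨y, hy, rfl⟩ := mem_intrinsicInterior.1 hω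
  let g : ℝ → affineSpan ℝ 𝓛.cone := fun ε =>
    ⟨AffineMap.lineMap (y : ι → ℝ) ω₀ (-ε),
      AffineMap.lineMap_mem _ y.2 (subset_affineSpan ℝ _ hω₀)⟩
  have hg : Continuous g := by
    refine Continuous.subtype_mk ?_ _
    exact AffineMap.lineMap_continuous.comp continuous_neg
  have hg0 : g 0 = y := by
    ext1
    simp [g]
  have hev : ∀ᶠ ε in 𝓝[>] (0 : ℝ), g ε ∈ ((↑) ⁻¹' 𝓛.cone : Set (affineSpan ℝ 𝓛.cone)) := by
    refine nhdsWithin_le_nhds (hg.continuousAt.eventually (f := g) ?_)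
    rw [hg0]
    exact mem_interior_iff_mem_nhds.1 hy
  obtain ⟨ε, hmem, hε : 0 < ε⟩ := (hev.and self_mem_nhdsWithin).exists
  have hmem' : AffineMap.lineMap (y : ι → ℝ) ω₀ (-ε) ∈ 𝓛.cone := hmem
  rw [inducedBy_iff (hb := hb)]
  refine fun i i' => ⟨fun h => ?_, fun h => ?_⟩
  · exact le_antisymm (le_of_mem_cone hωc h.le) (le_of_mem_cone hωc h.ge)
  · have h1 := le_of_mem_cone hmem' h.le
    simp only [AffineMap.lineMap_apply_module', Pi.add_apply, Pi.smul_apply, Pi.sub_apply,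
      smul_eq_mul] at h1
    have h2 : ω₀ i < ω₀ i' := by
      simp only [ω₀]
      exact_mod_cast h
    nlinarith [mul_pos hε (sub_pos.2 h2)]

theorem level_mem_relintCochars [Fintype ι] (hspan : Submodule.span ℂ (Set.range b) = ⊤)
    (hb : ∀ i, b i ≠ 0) : (fun i => ((𝓛.level hb i : ℕ) : ℤ)) ∈ relintCochars 𝓛.cone := by
  have hmem : (fun i => ((𝓛.level hb i : ℕ) : ℝ)) ∈ {ω | 𝓛.InducedBy ω} := inducedBy_level
  have hcone := cone_eq_closure_inducedBy (𝓛 := 𝓛) hspan hb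
  rw [relintCochars, Set.mem_ofPred_eq, mem_intrinsicInterior]
  simp only [Int.cast_natCast]
  refine ⟨⟨_, subset_affineSpan ℝ _ (hcone ▸ subset_closure hmem)⟩, ?_, rfl⟩
  -- the affine span of the cone consists of weights that are constant on the blocks
  let W : Submodule ℝ (ι → ℝ) :=
    { carrier := {ω | ∀ i i', 𝓛.level hb i = 𝓛.level hb i' → ω i = ω i'}
      add_mem' := fun h h' i i' hi => by simp [h i i' hi, h' i i' hi]
      zero_mem' := fun _ _ _ => rfl
      smul_mem' := fun a _ h i i' hi => by simp [h i i' hi] }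
  have hW : affineSpan ℝ 𝓛.cone ≤ W.toAffineSubspace := affineSpan_le.2 fun ω hω i i' h =>
    le_antisymm (le_of_mem_cone hω h.le) (le_of_mem_cone hω h.ge)
  let U : Set (ι → ℝ) := ⋂ i, ⋂ i', {ω | 𝓛.level hb i < 𝓛.level hb i' → ω i < ω i'}
  have hU : IsOpen U := by
    refine isOpen_iInter_of_finite fun i => isOpen_iInter_of_finite fun i' => ?_
    by_cases h : 𝓛.level hb i < 𝓛.level hb i'
    · simpa [h] using isOpen_lt (continuous_apply i) (continuous_apply i')
    · simp [h]
  refine mem_interior.2 ⟨(↑) ⁻¹' U, fun ω hω => ?_, hU.preimage continuous_subtype_val, ?_⟩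
  · refine Set.mem_preimage.2 (hcone.ge (subset_closure ((inducedBy_iff (hb := hb)).2 ?_)))
    simp only [U, Set.mem_preimage, Set.mem_iInter, Set.mem_ofPred_eq] at hω
    exact fun i i' => ⟨hW ω.2 i i', hω i i'⟩
  · simp only [U, Set.mem_preimage, Set.mem_iInter, Set.mem_ofPred_eq]
    intro i i' h
    exact_mod_cast h

end Flag

end Cones

/-! ### Evaluation of Laurent polynomials -/

section Evaluation

open Filter Topology

variable {ι : Type*}

/-- The coordinate functions of the torus. -/
noncomputable def coord (i : ι) : Laurent ι :=
  open Classical in AddMonoidAlgebra.single (Pi.single i 1) 1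

theorem isUnit_coord (i : ι) : IsUnit (coord i) := by
  classical
  refine IsUnit.of_mul_eq_one (AddMonoidAlgebra.single (-Pi.single i 1) 1) ?_
  rw [coord, AddMonoidAlgebra.single_mul_single]
  simp [AddMonoidAlgebra.one_def]

/-- Polynomials as Laurent polynomials. -/
noncomputable def polyToLaurent : MvPolynomial ι ℂ →ₐ[ℂ] Laurent ι := MvPolynomial.aeval coord

variable [Fintype ι]

theorem evalAt_single (x : Torus ι) (m : ι → ℤ) (a : ℂ) :
    evalAt x (AddMonoidAlgebra.single m a) = a * ((∏ i, x i ^ m i : ℂˣ) : ℂ) :=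
  AddMonoidAlgebra.lift_single _ _ _

theorem evalAt_coord (x : Torus ι) (i : ι) : evalAt x (coord i) = x i := by
  classical
  rw [coord, evalAt_single, Finset.prod_eq_single i]
  · simp
  · intro j _ hj
    simp [hj]
  · simp

theorem evalAt_smul (x : Torus ι) (a : ℂ) (g : Laurent ι) : evalAt x (a • g) = a * evalAt x g :=
  map_smul (AddMonoidAlgebra.lift ℂ ℂ (ι → ℤ) (monomialHom x)) a g

theorem evalFamily_zero (x : Torus ι) (f : Polynomial (Laurent ι)) :
    evalFamily 0 x f = evalAt x (f.eval 0) := by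
  rw [evalFamily, Polynomial.coe_eval₂RingHom, Polynomial.eval₂_at_zero,
    Polynomial.coeff_zero_eq_eval_zero]

theorem mem_vanishingIdeal {X : Set (Torus ι)} {f : Laurent ι} :
    f ∈ vanishingIdeal X ↔ ∀ x ∈ X, evalAt x f = 0 := by
  simp [vanishingIdeal, Submodule.mem_iInf]

theorem mem_familyIdeal {X : Set (Torus ι)} {α : ι → ℤ} {f : Polynomial (Laurent ι)} :
    f ∈ familyIdeal X α ↔
      ∀ (t : ℂˣ) (x : Torus ι), cocharMul α t x ∈ X → evalFamily (t : ℂ) x f = 0 := by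
  simp [familyIdeal, Submodule.mem_iInf]

theorem mem_initialIdeal {X : Set (Torus ι)} {α : ι → ℤ} {g : Laurent ι} :
    g ∈ initialIdeal X α ↔ ∃ f ∈ familyIdeal X α, f.eval 0 = g :=
  Ideal.mem_map_iff_of_surjective _ fun a => ⟨Polynomial.C a, by simp⟩

theorem continuous_evalAt (g : Laurent ι) : Continuous fun x : Torus ι => evalAt x g := by
  induction g using AddMonoidAlgebra.induction_linear with
  | zero => simpa using continuous_const
  | add f g hf hg =>
    simp only [map_add]
    exact hf.add hg
  | single m a =>
    simp only [evalAt_single]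
    refine continuous_const.mul (Units.continuous_val.comp ?_)
    exact continuous_finsetProd _ fun i _ => (continuous_apply i).zpow _

theorem continuous_evalFamily (f : Polynomial (Laurent ι)) :
    Continuous fun p : ℂ × Torus ι => evalFamily p.1 p.2 f := by
  simp only [evalFamily, Polynomial.coe_eval₂RingHom, Polynomial.eval₂_eq_sum_range]
  exact continuous_finsetSum _ fun n _ =>
    ((continuous_evalAt _).comp continuous_snd).mul (continuous_fst.pow n)

theorem evalAt_polyToLaurent (x : Torus ι) (p : MvPolynomial ι ℂ) :
    evalAt x (polyToLaurent p) = MvPolynomial.eval (fun i => (x i : ℂ)) p := by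
  induction p using MvPolynomial.induction_on with
  | C a =>
    rw [MvPolynomial.algHom_C, Algebra.algebraMap_eq_smul_one, evalAt_smul]
    simp
  | add p q hp hq => simp [hp, hq]
  | mul_X p i hp =>
    rw [map_mul, map_mul, map_mul, hp, MvPolynomial.eval_X, polyToLaurent, MvPolynomial.aeval_X,
      evalAt_coord]

/-- A Laurent polynomial becomes a polynomial after multiplication with a suitable monomial. -/
theorem exists_mul_eq_polyToLaurent (g : Laurent ι) :
    ∃ m p : MvPolynomial ι ℂ, IsUnit (polyToLaurent m) ∧ g * polyToLaurent m = polyToLaurent p := by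
  classical
  induction g using AddMonoidAlgebra.induction_linear with
  | zero => exact ⟨1, 0, by simp, by simp⟩
  | add f g hf hg =>
    obtain ⟨m, p, hm, hp⟩ := hf
    obtain ⟨n, q, hn, hq⟩ := hg
    refine ⟨m * n, p * n + q * m, by simpa using hm.mul hn, ?_⟩
    simp only [map_mul, map_add, ← hp, ← hq]
    ring
  | single e a =>
    have hmon : ∀ n : ι → ℕ, polyToLaurent (∏ i, MvPolynomial.X i ^ n i) =
        AddMonoidAlgebra.single (fun i => (n i : ℤ)) 1 := by
      intro n
      have h1 : ∀ i, (coord i : Laurent ι) ^ n i =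
          AddMonoidAlgebra.single (Pi.single i (n i : ℤ)) 1 := by
        intro i
        rw [coord, AddMonoidAlgebra.single_pow, one_pow]
        congr 1
        ext j
        by_cases h : j = i
        · subst h; simp
        · simp [h]
      simp only [polyToLaurent, map_prod, map_pow, MvPolynomial.aeval_X, h1]
      have h2 : ∀ s : Finset ι, ∏ i ∈ s, (AddMonoidAlgebra.single (Pi.single i (n i : ℤ)) 1 :
          Laurent ι) = AddMonoidAlgebra.single (∑ i ∈ s, Pi.single i (n i : ℤ)) 1 := by
        intro s
        induction s using Finset.induction_on with
        | empty => simp [AddMonoidAlgebra.one_def]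
        | insert i s hi ih =>
          rw [Finset.prod_insert hi, ih, Finset.sum_insert hi, AddMonoidAlgebra.single_mul_single,
            one_mul]
      rw [h2, Finset.univ_sum_single fun i => (n i : ℤ)]
    refine ⟨∏ i, MvPolynomial.X i ^ (-e i).toNat,
      MvPolynomial.C a * ∏ i, MvPolynomial.X i ^ (e i).toNat, ?_, ?_⟩
    · simp only [polyToLaurent, map_prod, map_pow, MvPolynomial.aeval_X]
      rw [IsUnit.prod_univ_iff]
      exact fun i => (isUnit_coord i).pow _
    · rw [map_mul, hmon, hmon, MvPolynomial.algHom_C, Algebra.algebraMap_eq_smul_one,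
        smul_mul_assoc, one_mul, AddMonoidAlgebra.single_mul_single, AddMonoidAlgebra.smul_single,
        smul_eq_mul]
      congr 1
      ext i
      simp only [Pi.add_apply]
      omega

end Evaluation

/-! ### The degeneration to the complement of a flag -/

section Degeneration

open Filter Topology

variable {V ι : Type*} [AddCommGroup V] [Module ℂ V] {b : ι → Module.Dual ℂ V}
  {α : ι → ℤ} {E : Finset ι} {c : ι → ι → ℂ} {𝓛 : Flag b}

/-- The coordinates of the point of the fibre over `t` of the family `{(t, x) | α(t) · x ∈ X}` whose
coordinates along the adapted basis are those of `z`. They are polynomial in `t`. -/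
noncomputable def familyPath (α : ι → ℤ) (E : Finset ι) (c : ι → ι → ℂ) (z : Torus ι) (t : ℂ)
    (i : ι) : ℂ :=
  ∑ e ∈ E, c i e * t ^ (α e - α i).toNat * z e

theorem continuous_familyPath (z : Torus ι) (i : ι) :
    Continuous fun t => familyPath α E c z t i := by
  unfold familyPath
  fun_prop

/-- The coefficients of the equations of the family specialize at `t = 0` to the leading ones. The
exponents `α e - α i` are nonnegative wherever `c i e ≠ 0`, so truncation does no harm. -/
theorem IsAdapted.coeff_mul_zero_pow (h : IsAdapted b (fun i => (α i : ℝ)) E c) {i e : ι}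
    (he : e ∈ E) {R : Type*} [Semiring R] (f : ℂ →+* R) :
    f (c i e) * 0 ^ (α e - α i).toNat = f (leadingCoeff (fun i => (α i : ℝ)) c i e) := by
  by_cases hce : c i e = 0
  · simp [leadingCoeff, hce]
  have hle : α i ≤ α e := by exact_mod_cast h.weight_le he hce
  rw [leadingCoeff]
  rcases hle.eq_or_lt with heq | hlt
  · simp [heq]
  · rw [zero_pow (by omega), if_neg (by exact_mod_cast hlt.ne), mul_zero, map_zero]

theorem IsAdapted.coeff_mul_zpow (h : IsAdapted b (fun i => (α i : ℝ)) E c) {i e : ι}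
    (he : e ∈ E) {t : ℂ} (ht : t ≠ 0) :
    t ^ α i * (c i e * t ^ (α e - α i).toNat) = c i e * t ^ α e := by
  by_cases hce : c i e = 0
  · simp [hce]
  have hle : α i ≤ α e := by exact_mod_cast h.weight_le he hce
  rw [← zpow_natCast, Int.toNat_of_nonneg (by omega), mul_left_comm, ← zpow_add₀ ht]
  congr 2
  omega

theorem IsAdapted.familyPath_zero (h : IsAdapted b (fun i => (α i : ℝ)) E c)
    (hb : ∀ i, b i ≠ 0) (hω : 𝓛.InducedBy fun i => (α i : ℝ)) {z : Torus ι}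
    (hz : z ∈ 𝓛.complement) (i : ι) : familyPath α E c z 0 i = z i := by
  rw [familyPath, h.eq_sum_of_mem_complement hb hω hz]
  refine Finset.sum_congr rfl fun e he => ?_
  have := h.coeff_mul_zero_pow (i := i) he (RingHom.id ℂ)
  simp only [RingHom.id_apply] at this
  rw [this]

theorem IsAdapted.cocharMul_mem_complement (h : IsAdapted b (fun i => (α i : ℝ)) E c)
    {z x : Torus ι} {t : ℂˣ} (hx : ∀ i, (x i : ℂ) = familyPath α E c z t i) :
    cocharMul α t x ∈ complement b := by
  obtain ⟨v, hv⟩ := h.solve fun e => (t : ℂ) ^ α e * z e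
  refine ⟨v, fun i => ?_⟩
  rw [cocharMul, Units.val_mul, Units.val_zpow_eq_zpow_val, hx, familyPath, h.apply_eq,
    Finset.mul_sum]
  refine Finset.sum_congr rfl fun e he => ?_
  rw [hv e he, ← mul_assoc, h.coeff_mul_zpow he t.ne_zero, mul_assoc]

variable [Fintype ι]

/-- Each point of the complement of a flag is the limit as `t` tends to zero of a path of
points of the family `{(t, x) | α(t) · x ∈ X}`. -/
theorem IsAdapted.exists_path (h : IsAdapted b (fun i => (α i : ℝ)) E c)
    (hb : ∀ i, b i ≠ 0) (hω : 𝓛.InducedBy fun i => (α i : ℝ)) {z : Torus ι}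
    (hz : z ∈ 𝓛.complement) : ∃ x : ℂ → Torus ι, Tendsto x (𝓝 0) (𝓝 z) ∧
      ∀ᶠ t in 𝓝 (0 : ℂ), ∀ s : ℂˣ, (s : ℂ) = t → cocharMul α s (x t) ∈ complement b := by
  classical
  -- where a coordinate vanishes, the value of the path is irrelevant
  let x : ℂ → Torus ι := fun t i =>
    if hne : familyPath α E c z t i ≠ 0 then Units.mk0 _ hne else 1
  have hev : ∀ᶠ t in 𝓝 (0 : ℂ), ∀ i, ((x t i : ℂˣ) : ℂ) = familyPath α E c z t i := by
    refine eventually_all.2 fun i => ?_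
    have h0 : familyPath α E c z 0 i ≠ 0 := by
      rw [h.familyPath_zero hb hω hz]
      exact (z i).ne_zero
    filter_upwards [(continuous_familyPath z i).continuousAt.eventually_ne h0] with t ht
    simp only [x, dif_pos ht, Units.val_mk0]
  refine ⟨x, tendsto_pi_nhds.2 fun i => ?_, ?_⟩
  · rw [Units.isEmbedding_val₀.tendsto_nhds_iff]
    refine ((continuous_familyPath (α := α) (E := E) (c := c) z i).tendsto' 0 _
      (h.familyPath_zero hb hω hz i)).congr' ?_
    filter_upwards [hev] with t ht
    exact (ht i).symm
  · filter_upwards [hev] with t ht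
    rintro s rfl
    exact h.cocharMul_mem_complement ht

/-- An equation of the family holds along the paths of `exists_path`, hence also in the limit. -/
theorem IsAdapted.initialIdeal_le (h : IsAdapted b (fun i => (α i : ℝ)) E c)
    (hb : ∀ i, b i ≠ 0) (hω : 𝓛.InducedBy fun i => (α i : ℝ)) :
    initialIdeal (complement b) α ≤ vanishingIdeal 𝓛.complement := by
  intro g hg
  obtain ⟨f, hf, rfl⟩ := mem_initialIdeal.1 hg
  rw [mem_familyIdeal] at hf
  refine mem_vanishingIdeal.2 fun z hz => ?_
  obtain ⟨x, hx, hmem⟩ := h.exists_path hb hω hz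
  have hpair : Tendsto (fun t => (t, x t)) (𝓝[≠] 0) (𝓝 ((0 : ℂ), z)) :=
    (tendsto_id.prodMk_nhds hx).mono_left nhdsWithin_le_nhds
  have hlim := ((continuous_evalFamily f).tendsto (0, z)).comp hpair
  simp only [Function.comp_def] at hlim
  have hzero : (fun t => evalFamily t (x t) f) =ᶠ[𝓝[≠] 0] fun _ => 0 := by
    filter_upwards [nhdsWithin_le_nhds hmem, self_mem_nhdsWithin] with t ht (ht0 : t ≠ 0)
    have h0 := hf (Units.mk0 t ht0) (x t) (ht (Units.mk0 t ht0) rfl)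
    rwa [Units.val_mk0] at h0
  rw [← evalFamily_zero]
  exact tendsto_nhds_unique (hlim.congr' hzero) tendsto_const_nhds

/-- The linear equation of the complement of a flag that expresses a coordinate by those along the
adapted basis. -/
noncomputable def flagEquation (ω : ι → ℝ) (E : Finset ι) (c : ι → ι → ℂ) (i : ι) : Laurent ι :=
  coord i - ∑ e ∈ E, leadingCoeff ω c i e • coord e

/-- The equation `xᵢ = ∑ c i e * t ^ (α e - α i) * xₑ` of the family specializes to an equation of
the complement of the flag. -/
theorem IsAdapted.flagEquation_mem (h : IsAdapted b (fun i => (α i : ℝ)) E c) (i : ι) :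
    flagEquation (fun i => (α i : ℝ)) E c i ∈ initialIdeal (complement b) α := by
  refine mem_initialIdeal.2 ⟨Polynomial.C (coord i) -
    ∑ e ∈ E, Polynomial.C (c i e • coord e) * Polynomial.X ^ (α e - α i).toNat, ?_, ?_⟩
  · refine mem_familyIdeal.2 fun t x ⟨v, hv⟩ => ?_
    simp only [evalFamily, Polynomial.coe_eval₂RingHom, Polynomial.eval₂_sub,
      Polynomial.eval₂_finsetSum, Polynomial.eval₂_mul, Polynomial.eval₂_C, Polynomial.eval₂_pow,
      Polynomial.eval₂_X, evalAt_smul, evalAt_coord, sub_eq_zero]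
    have ht : (t : ℂ) ^ α i ≠ 0 := zpow_ne_zero _ t.ne_zero
    have hv' : ∀ i, (t : ℂ) ^ α i * x i = b i v := fun i => by
      rw [← hv, cocharMul, Units.val_mul, Units.val_zpow_eq_zpow_val]
    refine mul_left_cancel₀ ht ?_
    rw [hv', h.apply_eq, Finset.mul_sum]
    refine Finset.sum_congr rfl fun e he => ?_
    rw [← hv', ← mul_assoc, ← h.coeff_mul_zpow he t.ne_zero]
    ring
  · rw [Polynomial.eval_sub, Polynomial.eval_C, Polynomial.eval_finsetSum, flagEquation]
    congr 1
    refine Finset.sum_congr rfl fun e he => ?_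
    have h1 := h.coeff_mul_zero_pow (i := i) he (algebraMap ℂ (Laurent ι))
    rw [Polynomial.eval_mul, Polynomial.eval_C, Polynomial.eval_pow, Polynomial.eval_X,
      Algebra.smul_def, Algebra.smul_def, ← h1]
    ring

/-- The linear equations generate the whole vanishing ideal of the complement of a flag, since a
linear space is irreducible and the torus meets it in a nonempty open set. -/
theorem vanishingIdeal_le_of_flagEquation_mem {ω : ι → ℝ} (h : IsAdapted b ω E c)
    (hb : ∀ i, b i ≠ 0) (hω : 𝓛.InducedBy ω) {J : Ideal (Laurent ι)}
    (hJ : ∀ i, flagEquation ω E c i ∈ J) : vanishingIdeal 𝓛.complement ≤ J := by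
  intro g hg
  rw [mem_vanishingIdeal] at hg
  obtain ⟨m, p, hm, hp⟩ := exists_mul_eq_polyToLaurent g
  let s : ι → MvPolynomial ι ℂ := fun i =>
    ∑ e ∈ E, leadingCoeff ω c i e • MvPolynomial.X e
  have hs : ∀ (u : ι → ℂ) i, MvPolynomial.eval u (s i) =
      ∑ e ∈ E, leadingCoeff ω c i e * u e := fun u i => by
    simp [s, MvPolynomial.smul_eval]
  -- modulo `J`, every polynomial agrees with its pullback along the parametrization `s`
  have hquot : ∀ q : MvPolynomial ι ℂ,
      Ideal.Quotient.mkₐ ℂ J (polyToLaurent q) =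
        Ideal.Quotient.mkₐ ℂ J (polyToLaurent (MvPolynomial.bind₁ s q)) := by
    intro q
    refine DFunLike.congr_fun (F := MvPolynomial ι ℂ →ₐ[ℂ] Laurent ι ⧸ J)
      (f := (Ideal.Quotient.mkₐ ℂ J).comp polyToLaurent)
      (g := ((Ideal.Quotient.mkₐ ℂ J).comp polyToLaurent).comp (MvPolynomial.bind₁ s)) ?_ q
    refine MvPolynomial.algHom_ext fun i => ?_
    simp only [AlgHom.comp_apply, MvPolynomial.bind₁_X_right]
    refine Ideal.Quotient.eq.2 ?_
    convert hJ i using 1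
    simp [flagEquation, polyToLaurent, s]
  have hsne : ∀ i, s i ≠ 0 := by
    classical
    intro i h0
    obtain ⟨e, he, hne⟩ := h.exists_leadingCoeff_ne_zero hb hω i
    have h1 := hs (Pi.single e 1) i
    rw [h0, map_zero, Finset.sum_eq_single_of_mem e he fun e' _ hee' => by
      rw [Pi.single_eq_of_ne hee', mul_zero]] at h1
    exact hne (by simpa using h1.symm)
  -- the pullback vanishes wherever the parametrization ends in the torus, hence identically
  have hpull : MvPolynomial.bind₁ s p = 0 := by
    have hprod : (∏ i, s i) * MvPolynomial.bind₁ s p = 0 := by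
      refine MvPolynomial.funext fun u => ?_
      rw [map_mul, map_prod, map_zero]
      by_cases hu : ∀ i, MvPolynomial.eval u (s i) ≠ 0
      · let z : Torus ι := fun i => Units.mk0 _ (hu i)
        have hz : z ∈ 𝓛.complement := h.mem_complement hb hω u fun i => hs u i
        have h1 : evalAt z (polyToLaurent p) = 0 := by
          rw [← hp, map_mul, hg z hz, zero_mul]
        rw [evalAt_polyToLaurent] at h1
        have h2 : MvPolynomial.eval u (MvPolynomial.bind₁ s p) =
            MvPolynomial.eval (fun i => (z i : ℂ)) p :=
          MvPolynomial.eval₂Hom_bind₁ (RingHom.id ℂ) u s p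
        rw [h2, h1, mul_zero]
      · push Not at hu
        obtain ⟨i, hi⟩ := hu
        rw [Finset.prod_eq_zero (Finset.mem_univ i) hi, zero_mul]
    exact (mul_eq_zero.1 hprod).resolve_left (Finset.prod_ne_zero_iff.2 fun i _ => hsne i)
  have h1 : polyToLaurent p ∈ J := by
    have := hquot p
    rw [hpull, map_zero, map_zero] at this
    exact Ideal.Quotient.eq_zero_iff_mem.1 this
  rw [← hp] at h1
  exact (Ideal.mul_unit_mem_iff_mem J hm).1 h1

theorem zeroLocus_vanishingIdeal_complement {ω : ι → ℝ} (h : IsAdapted b ω E c)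
    (hb : ∀ i, b i ≠ 0) (hω : 𝓛.InducedBy ω) :
    zeroLocus (vanishingIdeal 𝓛.complement) = 𝓛.complement := by
  have heval : ∀ (z : Torus ι) i, evalAt z (flagEquation ω E c i) = 0 ↔
      (z i : ℂ) = ∑ e ∈ E, leadingCoeff ω c i e * z e := fun z i => by
    simp only [flagEquation, map_sub, map_sum, evalAt_smul, evalAt_coord, sub_eq_zero]
  refine Set.Subset.antisymm (fun z hz => ?_) fun z hz f hf => mem_vanishingIdeal.1 hf z hz
  refine h.mem_complement hb hω (fun e => z e) fun i => (heval z i).1 (hz _ ?_)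
  exact mem_vanishingIdeal.2 fun y hy =>
    (heval y i).2 (h.eq_sum_of_mem_complement hb hω hy i)

theorem schemeEq_initialIdeal [FiniteDimensional ℂ V]
    (hspan : Submodule.span ℂ (Set.range b) = ⊤) (hb : ∀ i, b i ≠ 0)
    (hω : 𝓛.InducedBy fun i => (α i : ℝ)) :
    SchemeEq (initialIdeal (complement b) α) 𝓛.complement := by
  obtain ⟨E, -, c, h⟩ := exists_isAdapted hspan fun i => (α i : ℝ)
  have heq : initialIdeal (complement b) α = vanishingIdeal 𝓛.complement :=
    le_antisymm (h.initialIdeal_le hb hω)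
      (vanishingIdeal_le_of_flagEquation_mem h hb hω h.flagEquation_mem)
  exact ⟨heq, heq ▸ zeroLocus_vanishingIdeal_complement h hb hω⟩

theorem schemeEq_coneInitialIdeal [FiniteDimensional ℂ V]
    (hspan : Submodule.span ℂ (Set.range b) = ⊤) (hb : ∀ i, b i ≠ 0) (𝓛 : Flag b) :
    SchemeEq (coneInitialIdeal (complement b) 𝓛.cone) 𝓛.complement := by
  have hrel : ∀ α ∈ relintCochars 𝓛.cone,
      SchemeEq (initialIdeal (complement b) α) 𝓛.complement := fun α hα =>
    schemeEq_initialIdeal hspan hb (Flag.inducedBy_of_mem_intrinsicInterior hspan hb hα)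
  have hlevel := Flag.level_mem_relintCochars (𝓛 := 𝓛) hspan hb
  have heq : coneInitialIdeal (complement b) 𝓛.cone = vanishingIdeal 𝓛.complement := by
    rw [coneInitialIdeal, biSup_congr fun α hα => (hrel α hα).1]
    exact biSup_const ⟨_, hlevel⟩
  have h := hrel _ hlevel
  exact ⟨heq, by rw [heq, ← h.1, h.2]⟩

end Degeneration

/-! ### Phase limits -/

section PhaseLimits

open Filter Topology

theorem continuous_argUnit : Continuous argUnit := by
  refine Continuous.subtype_mk ?_ _
  refine Units.continuous_val.div ?_ fun z => by simp
  exact Complex.continuous_ofReal.comp (continuous_norm.comp Units.continuous_val)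

theorem argUnit_mul_of_pos {r : ℝ} (hr : 0 < r) {y z : ℂˣ} (h : (y : ℂ) = r * z) :
    argUnit y = argUnit z := by
  refine Subtype.ext ?_
  have hr' : (r : ℂ) ≠ 0 := by exact_mod_cast hr.ne'
  change (y : ℂ) / ((‖(y : ℂ)‖ : ℝ) : ℂ) = (z : ℂ) / ((‖(z : ℂ)‖ : ℝ) : ℂ)
  rw [h, norm_mul, Complex.norm_real, Real.norm_of_nonneg hr.le, Complex.ofReal_mul,
    mul_div_mul_left _ _ hr']

theorem continuous_Arg {ι : Type*} : Continuous (Arg : Torus ι → CompactTorus ι) :=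
  continuous_pi fun i => continuous_argUnit.comp (continuous_apply i)

variable {V ι : Type*} [AddCommGroup V] [Module ℂ V] [Fintype ι] {b : ι → Module.Dual ℂ V}

/-- The path `t ↦ α(t) · x(t)`, for real `t > 0`, has the same arguments as `x(t)` and leaves every
bounded region, because `α` is not zero. -/
theorem exists_mem_complement_Arg_near [FiniteDimensional ℂ V]
    (hspan : Submodule.span ℂ (Set.range b) = ⊤) (hb : ∀ i, b i ≠ 0) {𝓛 : Flag b}
    (hk : 𝓛.k ≠ 0) {z : Torus ι} (hz : z ∈ 𝓛.complement) {U : Set (CompactTorus ι)}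
    (hU : U ∈ 𝓝 (Arg z)) (R : ℝ) : ∃ x ∈ complement b, Arg x ∈ U ∧ R ≤ ‖Log x‖ := by
  let α : ι → ℤ := fun i => ((𝓛.level hb i : ℕ) : ℤ)
  have hω : 𝓛.InducedBy fun i => (α i : ℝ) := by
    simpa [α] using Flag.inducedBy_level (𝓛 := 𝓛) (hb := hb)
  obtain ⟨E, -, c, h⟩ := exists_isAdapted hspan fun i => (α i : ℝ)
  obtain ⟨x, hx, hmem⟩ := h.exists_path hb hω hz
  obtain ⟨i, hi⟩ := 𝓛.block_nonempty (Fin.last _)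
  have hαi : (α i : ℝ) = 𝓛.k := by
    rw [Flag.mem_block_iff (hb := hb)] at hi
    simp [α, hi]
  have hreal : Tendsto (fun r : ℝ => (r : ℂ)) (𝓝[>] 0) (𝓝 0) :=
    tendsto_nhdsWithin_of_tendsto_nhds (Complex.continuous_ofReal.tendsto' 0 0 (by simp))
  have hArg : ∀ᶠ r : ℝ in 𝓝[>] 0, Arg (x r) ∈ U :=
    ((continuous_Arg.tendsto z).comp (hx.comp hreal)).eventually_mem hU
  have hnorm : Tendsto (fun r : ℝ => Real.log ‖(x r i : ℂ)‖) (𝓝[>] 0)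
      (𝓝 (Real.log ‖(z i : ℂ)‖)) := by
    refine (Tendsto.log ?_ (by simp))
    refine ((continuous_norm.comp Units.continuous_val).tendsto (z i)).comp ?_
    exact (tendsto_pi_nhds.1 (hx.comp hreal)) i
  have hlog : Tendsto (fun r : ℝ => (𝓛.k : ℝ) * Real.log r + Real.log ‖(x r i : ℂ)‖) (𝓝[>] 0)
      atBot :=
    (Real.tendsto_log_nhdsGT_zero.const_mul_atBot (by positivity)).atBot_add hnorm
  obtain ⟨r, hr1, hr2, hr3, hr : 0 < r⟩ := (((hreal.eventually hmem).and
    (hArg.and ((hlog.eventually_le_atBot (-R)).and self_mem_nhdsWithin)))).exists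
  have hr' : (r : ℂ) ≠ 0 := by exact_mod_cast hr.ne'
  let t : ℂˣ := Units.mk0 r hr'
  have hval : ∀ i, ((cocharMul α t (x r) i : ℂˣ) : ℂ) = ((r ^ α i : ℝ) : ℂ) * x r i := fun i => by
    simp [cocharMul, t]
  refine ⟨_, hr1 t rfl, ?_, ?_⟩
  · have : Arg (cocharMul α t (x r)) = Arg (x r) :=
      funext fun i => argUnit_mul_of_pos (zpow_pos hr _) (hval i)
    rwa [this]
  · refine le_trans ?_ (norm_le_pi_norm (Log (cocharMul α t (x r))) i)
    have h1 : Log (cocharMul α t (x r)) i = (𝓛.k : ℝ) * Real.log r + Real.log ‖(x r i : ℂ)‖ := by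
      rw [Log, hval, norm_mul, Complex.norm_real, Real.norm_of_nonneg (zpow_pos hr _).le,
        Real.log_mul (zpow_pos hr _).ne' (by simp), Real.log_zpow, hαi]
    rw [h1]
    exact (le_neg_of_le_neg hr3).trans (neg_le_abs _)

theorem closure_coamoeba_subset_phaseLimitSet [FiniteDimensional ℂ V]
    (hspan : Submodule.span ℂ (Set.range b) = ⊤) (hb : ∀ i, b i ≠ 0) {𝓛 : Flag b}
    (hk : 𝓛.k ≠ 0) : closure (coamoeba 𝓛.complement) ⊆ phaseLimitSet (complement b) := by
  intro θ hθ
  obtain ⟨U, hU⟩ := (𝓝 θ).exists_antitone_basis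
  have hx : ∀ n : ℕ, ∃ x ∈ complement b, Arg x ∈ U n ∧ (n : ℝ) ≤ ‖Log x‖ := by
    intro n
    obtain ⟨_, hyU, z, hz, rfl⟩ :=
      mem_closure_iff_nhds.1 hθ _ (interior_mem_nhds.2 (hU.mem n))
    exact exists_mem_complement_Arg_near hspan hb hk hz
      (mem_interior_iff_mem_nhds.1 hyU) n
  choose x hx hxU hxn using hx
  exact ⟨x, hx, tendsto_atTop_mono hxn tendsto_natCast_atTop_atTop,
    (hU.tendsto hxU).mapClusterPt⟩

end PhaseLimits

/-! ### The strata of the phase limit set -/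

theorem finiteDimensional_of_span_dual {V ι : Type*} [AddCommGroup V] [Module ℂ V] [Finite ι]
    {b : ι → Module.Dual ℂ V} (hspan : Submodule.span ℂ (Set.range b) = ⊤) :
    FiniteDimensional ℂ V := by
  have : Module.Finite ℂ (Module.Dual ℂ V) :=
    Module.finite_def.2 (hspan ▸ Submodule.fg_span (Set.finite_range b))
  exact Module.finite_dual_iff ℂ |>.1 this

end PhaseLimit

theorem corollary2p5 {V ι : Type*} [AddCommGroup V] [Module ℂ V] [Fintype ι]
    (b : ι → Module.Dual ℂ V) (hb : ∀ i, b i ≠ 0)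
    (hspan : Submodule.span ℂ (Set.range b) = ⊤) :
    -- the initial scheme of the cone of a flag is well defined, and is the product complement
    (∀ 𝓛 : PhaseLimit.Flag b,
      (PhaseLimit.relintCochars 𝓛.cone).Nonempty ∧
      (∀ α ∈ PhaseLimit.relintCochars 𝓛.cone,
        PhaseLimit.SchemeEq (PhaseLimit.initialIdeal (PhaseLimit.complement b) α)
          𝓛.complement) ∧
      PhaseLimit.SchemeEq (PhaseLimit.coneInitialIdeal (PhaseLimit.complement b) 𝓛.cone)
        𝓛.complement) ∧
    (∀ 𝓛 : PhaseLimit.Flag b,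
      PhaseLimit.coneStratum (PhaseLimit.complement b) 𝓛.cone =
        closure (PhaseLimit.coamoeba 𝓛.complement)) ∧
    -- the strata of the phase limit set are the closures of the terms of nontrivial flags
    (∀ P : Set (PhaseLimit.CompactTorus ι),
      P ∈ PhaseLimit.strata (PhaseLimit.complement b) (PhaseLimit.fineSubdivision b) ↔
        ∃ 𝓛 : PhaseLimit.Flag b, 𝓛.k ≠ 0 ∧
          P = closure (PhaseLimit.coamoeba 𝓛.complement)) ∧
    (∀ P ∈ PhaseLimit.strata (PhaseLimit.complement b) (PhaseLimit.fineSubdivision b),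
      P ⊆ PhaseLimit.phaseLimitSet (PhaseLimit.complement b)) := by
  have := PhaseLimit.finiteDimensional_of_span_dual hspan
  have hcone : ∀ 𝓛 : PhaseLimit.Flag b,
      PhaseLimit.coneStratum (PhaseLimit.complement b) 𝓛.cone =
        closure (PhaseLimit.coamoeba 𝓛.complement) := fun 𝓛 => by
    rw [PhaseLimit.coneStratum, (PhaseLimit.schemeEq_coneInitialIdeal hspan hb 𝓛).2]
  have hstrata : ∀ P : Set (PhaseLimit.CompactTorus ι),
      P ∈ PhaseLimit.strata (PhaseLimit.complement b) (PhaseLimit.fineSubdivision b) ↔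
        ∃ 𝓛 : PhaseLimit.Flag b, 𝓛.k ≠ 0 ∧
          P = closure (PhaseLimit.coamoeba 𝓛.complement) := by
    intro P
    constructor
    · rintro ⟨_, ⟨𝓛, rfl⟩, hne, rfl⟩
      exact ⟨𝓛, fun hk => hne ((𝓛.cone_eq_sInter_iff hspan hb).2 hk), hcone 𝓛⟩
    · rintro ⟨𝓛, hk, rfl⟩
      exact ⟨_, ⟨𝓛, rfl⟩, fun heq => hk ((𝓛.cone_eq_sInter_iff hspan hb).1 heq),
        (hcone 𝓛).symm⟩
  refine ⟨fun 𝓛 => ⟨⟨_, PhaseLimit.Flag.level_mem_relintCochars hspan hb⟩, fun α hα => ?_,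
    PhaseLimit.schemeEq_coneInitialIdeal hspan hb 𝓛⟩, hcone, hstrata, fun P hP => ?_⟩
  · exact PhaseLimit.schemeEq_initialIdeal hspan hb
      (PhaseLimit.Flag.inducedBy_of_mem_intrinsicInterior hspan hb hα)
  · obtain ⟨𝓛, hk, rfl⟩ := (hstrata P).1 hP
    exact PhaseLimit.closure_coamoeba_subset_phaseLimitSet hspan hb hk
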